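/- A (discrete) group $\Gamma$ is called maximally almost periodic (MAP) if its finite-dimensional unitary representations separate its points, i.e. for all $x\neq y$ in $\Gamma$ there are $n\in\mathbb N$ and a homomorphism $\pi:\Gamma\to U(n)$ with $\pi(x)\neq\pi(y)$; it is called residually finite (RF) if the intersection of all its normal subgroups of finite index is trivial. For groups $H$ and $G$, the regular wreath product is the semidirect product $H\wr G:=\left(\bigoplus_{g\in G}H\right)\rtimes G$, where $\bigoplus_{g\in G}H$ is the group of families $(h_g)_{g\in G}$ in $H$ with $h_g=e$ for all but finitely many $g$, and $G$ acts on it by $g_0\cdot(h_g)_{g\in G}=(h_{g_0^{-1}g})_{g\in G}$. Theorem. Let $H$ and $G$ be discrete groups. Then $H\wr G$ is MAP if and only if at least one of the following holds: (1) $H$ is MAP and $G$ is finite; (2) $H$ is trivial and $G$ is MAP; (3) $H$ is abelian and $G$ is RF. -/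

import Mathlib

/-- A (discrete) group is *maximally almost periodic* if its finite-dimensional unitary
representations separate its points. -/
def IsMAP (G : Type*) [Group G] : Prop :=
  ∀ x y : G, x ≠ y →
    ∃ (n : ℕ) (π : G →* Matrix.unitaryGroup (Fin n) ℂ), π x ≠ π y

/-- The restricted direct power `⊕_{g ∈ G} H`: families `(h_g)` in `H` indexed by `G` with
`h_g = 1` for all but finitely many `g`, with pointwise multiplication. -/
def directPower (H G : Type*) [Group H] : Subgroup (G → H) where
  carrier := {f | (Function.mulSupport f).Finite}
  one_mem' := by simp
  mul_mem' := by
    intro a b ha hb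
    exact (ha.union hb).subset (Function.mulSupport_mul a b)
  inv_mem' := by
    intro a ha
    simpa only [Set.mem_ofPred_eq, Function.mulSupport_inv] using ha

theorem directPower_translate {H G : Type*} [Group H] [Group G] (g : G)
    {f : G → H} (hf : f ∈ directPower H G) :
    (fun x => f (g⁻¹ * x)) ∈ directPower H G := by
  have h : (Function.mulSupport f).Finite := hf
  have h2 := h.preimage (f := fun x => g⁻¹ * x) (mul_right_injective g⁻¹).injOn
  exact h2

/-- The action of `G` on `⊕_{g ∈ G} H` by left translation,
`g₀ • (h_g)_g = (h_{g₀⁻¹ g})_g`. -/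
def shiftAction (H G : Type*) [Group H] [Group G] : G →* MulAut (directPower H G) where
  toFun g :=
    { toFun := fun f => ⟨fun x => f.1 (g⁻¹ * x), directPower_translate g f.2⟩
      invFun := fun f => ⟨fun x => f.1 (g * x), by
        simpa only [inv_inv] using directPower_translate g⁻¹ f.2⟩
      left_inv := by
        intro f
        ext x
        simp
      right_inv := by
        intro f
        ext x
        simp
      map_mul' := by
        intro a b
        rfl }
  map_one' := by
    ext f x
    simp
  map_mul' := by
    intro a b
    ext f x
    simp [mul_assoc]

/-- The regular (restricted) wreath product `H ≀ G = (⊕_{g ∈ G} H) ⋊ G`. -/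
abbrev WreathProduct (H G : Type*) [Group H] [Group G] : Type _ :=
  directPower H G ⋊[shiftAction H G] G

/-! For finite `G`, a representation of `H` induces a monomial representation of the wreath product
that still sees each coordinate. For abelian `H`, multiplying along the fibres of `G → G/N` maps `H
≀ G` to `H ≀ (G/N)`; a suitable `N` of finite index keeps a given element nontrivial.

The converse uses compactness of U(n). If `G` is infinite, some `k ≠ 1` acts almost as the identity;
conjugation by `k` barely moves a copy of `H`, yet takes it to a copy commuting with it, so the
image of `H` is abelian (`commute_of_forall_conj_commute`). If `a ≠ 1` in `H`, the translates of `a`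
have commuting images with a common finite spectrum, hence finitely many images
(`finite_of_pairwise_commute_of_spectrum_subset`). Their stabilizer has finite index in `G` and
omits `g` when the representation separates `a` at `g` from `a` at `1`. -/

section Unitarizable

variable {Γ ι : Type*} [Group Γ] [Fintype ι] [DecidableEq ι]

/-- A matrix representation satisfying `π(g)ᴴ = π(g⁻¹)` as a homomorphism to the unitary group. -/
def unitaryRepOfStar (π : Γ →* Matrix ι ι ℂ) (h : ∀ g, star (π g) = π g⁻¹) :
    Γ →* Matrix.unitaryGroup ι ℂ :=
  π.codRestrict _ fun g => by
    rw [Matrix.mem_unitaryGroup_iff, h, ← map_mul, mul_inv_cancel, map_one]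

theorem exists_fin_unitaryRep (π : Γ →* Matrix.unitaryGroup ι ℂ) {x : Γ} (hx : π x ≠ 1) :
    ∃ (n : ℕ) (ρ : Γ →* Matrix.unitaryGroup (Fin n) ℂ), ρ x ≠ 1 := by
  let e := Matrix.reindexAlgEquiv ℂ ℂ (Fintype.equivFin ι)
  refine ⟨Fintype.card ι, unitaryRepOfStar
    ((e : Matrix ι ι ℂ →* Matrix _ _ ℂ).comp ((Submonoid.subtype _).comp π)) ?_, ?_⟩
  · intro g
    have h : star (π g : Matrix ι ι ℂ) = (π g⁻¹ : Matrix ι ι ℂ) := by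
      rw [map_inv]
      rfl
    ext i j
    exact congrFun₂ h _ _
  · intro h
    apply hx
    have h' : e (π x : Matrix ι ι ℂ) = 1 := congrArg Subtype.val h
    rw [← map_one e] at h'
    exact Subtype.ext (e.injective h')

theorem isMAP_of_forall_ne_one
    (h : ∀ x : Γ, x ≠ 1 → ∃ (n : ℕ) (π : Γ →* Matrix.unitaryGroup (Fin n) ℂ), π x ≠ 1) :
    IsMAP Γ := by
  intro x y hxy
  obtain ⟨n, π, hπ⟩ := h (x * y⁻¹) (by rwa [ne_eq, mul_inv_eq_one])
  refine ⟨n, π, fun h => hπ ?_⟩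
  rw [map_mul, map_inv, h, mul_inv_cancel]

theorem IsMAP.exists_ne_one (hΓ : IsMAP Γ) {x : Γ} (hx : x ≠ 1) :
    ∃ (n : ℕ) (π : Γ →* Matrix.unitaryGroup (Fin n) ℂ), π x ≠ 1 := by
  obtain ⟨n, π, hπ⟩ := hΓ x 1 hx
  exact ⟨n, π, by rwa [map_one] at hπ⟩

theorem isMAP_of_separating_homs
    (h : ∀ x : Γ, x ≠ 1 → ∃ (Δ : Type*) (_ : Group Δ) (φ : Γ →* Δ), IsMAP Δ ∧ φ x ≠ 1) :
    IsMAP Γ := by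
  refine isMAP_of_forall_ne_one fun x hx => ?_
  obtain ⟨Δ, _, φ, hΔ, hφ⟩ := h x hx
  obtain ⟨n, π, hπ⟩ := hΔ.exists_ne_one hφ
  exact ⟨n, π.comp φ, hπ⟩

theorem IsMAP.of_injective {Δ : Type*} [Group Δ] (hΔ : IsMAP Δ) (φ : Γ →* Δ)
    (hφ : Function.Injective φ) : IsMAP Γ :=
  isMAP_of_separating_homs fun x hx =>
    ⟨Δ, inferInstance, φ, hΔ, by rwa [ne_eq, map_eq_one_iff φ hφ]⟩

end Unitarizable

/-! ### Finite `G`: induced monomial representations. -/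

section Imprimitive

variable {H G : Type*} [Group H] [Group G]

theorem WreathProduct.mul_left_apply (v w : WreathProduct H G) (x : G) :
    (v * w).left.1 x = v.left.1 x * w.left.1 (v.right⁻¹ * x) := rfl

theorem WreathProduct.inv_left_apply (w : WreathProduct H G) (x : G) :
    (w⁻¹).left.1 x = (w.left.1 (w.right * x))⁻¹ := by
  simp [shiftAction]

variable [Fintype G] [DecidableEq G] {n : Type*} [Fintype n] [DecidableEq n]

/-- The monomial representation of `H ≀ G` on `ℂ^G ⊗ ℂⁿ` induced by a representation of `H`. -/
def imprimitiveRep (ρ : H →* Matrix.unitaryGroup n ℂ) :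
    WreathProduct H G →* Matrix.unitaryGroup (G × n) ℂ :=
  unitaryRepOfStar
    { toFun := fun w => Matrix.of fun p q =>
        if q.1 = w.right⁻¹ * p.1 then (ρ (w.left.1 p.1) : Matrix n n ℂ) p.2 q.2 else 0
      map_one' := by
        ext ⟨x, i⟩ ⟨y, j⟩
        by_cases h : x = y <;> simp [Matrix.one_apply, h, eq_comm (a := y)]
      map_mul' := fun v w => by
        ext ⟨x, i⟩ ⟨y, j⟩
        rw [Matrix.mul_apply, Fintype.sum_prod_type, Finset.sum_eq_single (v.right⁻¹ * x)]
        · by_cases h : y = w.right⁻¹ * (v.right⁻¹ * x)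
          · simp only [Matrix.of_apply, WreathProduct.mul_left_apply, h, map_mul,
              SemidirectProduct.mul_right, mul_inv_rev, mul_assoc, if_true]
            exact Matrix.mul_apply
          · simp [h, mul_assoc]
        · intro z _ hz
          simp [hz]
        · simp }
    (fun w => by
      ext ⟨x, i⟩ ⟨y, j⟩
      by_cases h : y = w.right * x
      · subst h
        simp only [Matrix.star_apply, MonoidHom.coe_mk, OneHom.coe_mk, Matrix.of_apply,
          WreathProduct.inv_left_apply, map_inv, SemidirectProduct.inv_right, inv_inv,
          inv_mul_cancel_left, if_true]
        rfl
      · have h' : x ≠ w.right⁻¹ * y := by rwa [ne_eq, eq_inv_mul_iff_mul_eq, eq_comm]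
        simp [Matrix.star_apply, h, h'])

theorem imprimitiveRep_apply (ρ : H →* Matrix.unitaryGroup n ℂ) (w : WreathProduct H G)
    (x y : G) (i j : n) :
    (imprimitiveRep ρ w : Matrix (G × n) (G × n) ℂ) (x, i) (y, j) =
      if y = w.right⁻¹ * x then (ρ (w.left.1 x) : Matrix n n ℂ) i j else 0 := rfl

end Imprimitive

theorem isMAP_wreathProduct_of_finite {H G : Type*} [Group H] [Group G] [Finite G]
    (hH : IsMAP H) : IsMAP (WreathProduct H G) := by
  classical
  have := Fintype.ofFinite G
  refine isMAP_of_forall_ne_one fun w hw => ?_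
  by_cases hr : w.right = 1
  · obtain ⟨x, hx⟩ : ∃ x, w.left.1 x ≠ 1 := by
      by_contra! h
      exact hw (SemidirectProduct.ext (Subtype.ext (funext h)) hr)
    obtain ⟨n, ρ, hρ⟩ := hH.exists_ne_one hx
    refine exists_fin_unitaryRep (imprimitiveRep ρ) fun h => hρ ?_
    ext i j
    have h' := congrFun₂ (congrArg Subtype.val h) (x, i) (x, j)
    rw [imprimitiveRep_apply] at h'
    simpa [hr, Matrix.one_apply] using h'
  -- The trivial representation of `H` induces the regular permutation representation of `G`, whose
  -- diagonal entries vanish off the identity.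
  · refine exists_fin_unitaryRep (imprimitiveRep (1 : H →* Matrix.unitaryGroup (Fin 1) ℂ))
      fun h => hr ?_
    have h' := congrFun₂ (congrArg Subtype.val h) (1, 0) (1, 0)
    rw [imprimitiveRep_apply] at h'
    by_contra hne
    have hne' : (1 : G) ≠ w.right⁻¹ := by rwa [ne_eq, eq_comm, inv_eq_one]
    simp [hne'] at h'

/-! ### Abelian `H`: characters and finite quotients of `G`. -/

section Abelian

/-- Characters into the divisible group ℚ/ℤ separate points, and ℚ/ℤ embeds in ℝ/ℤ, which is the
circle. -/
theorem exists_circle_hom_ne_one {A : Type*} [CommGroup A] {a : A} (ha : a ≠ 1) :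
    ∃ χ : A →* Circle, χ a ≠ 1 := by
  obtain ⟨c, hc⟩ := CharacterModule.exists_character_apply_ne_zero_of_ne_zero
    (A := Additive A) (a := Additive.ofMul a) (by simpa using ha)
  have hle : AddSubgroup.zmultiples (1 : ℚ) ≤
      (AddSubgroup.zmultiples (1 : ℝ)).comap (Rat.castHom ℝ : ℚ →+ ℝ) := by
    rintro _ ⟨n, rfl⟩
    exact ⟨n, by simp⟩
  let f : AddCircle (1 : ℚ) →+ AddCircle (1 : ℝ) := QuotientAddGroup.map _ _ _ hle
  have hf : ∀ q, f q = 0 → q = 0 := by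
    intro q
    induction q using QuotientAddGroup.induction_on with
    | H q =>
      intro h
      obtain ⟨n, hn⟩ := (QuotientAddGroup.eq_zero_iff _).1 h
      refine (QuotientAddGroup.eq_zero_iff _).2 ⟨n, ?_⟩
      have hn' : (n : ℝ) = (q : ℝ) := by simpa using hn
      simpa using (by exact_mod_cast hn' : (n : ℚ) = q)
  let χ : A →* Circle :=
    { toFun := fun x => AddCircle.toCircle (f (c (Additive.ofMul x)))
      map_one' := by
        rw [ofMul_one, map_zero, map_zero, AddCircle.toCircle_zero]
      map_mul' := fun x y => by
        rw [ofMul_mul, map_add, map_add, AddCircle.toCircle_add] }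
  refine ⟨χ, fun h => hc (hf _ (AddCircle.injective_toCircle one_ne_zero ?_))⟩
  rw [AddCircle.toCircle_zero]
  exact h

theorem isMAP_of_commGroup (A : Type*) [CommGroup A] : IsMAP A := by
  refine isMAP_of_forall_ne_one fun a ha => ?_
  obtain ⟨χ, hχ⟩ := exists_circle_hom_ne_one ha
  refine ⟨1, unitaryRepOfStar ((Matrix.scalar (Fin 1)).toMonoidHom.comp
    (Circle.coeHom.comp χ)) ?_, fun h => hχ ?_⟩
  · intro g
    ext i j
    simp only [MonoidHom.comp_apply, Subsingleton.elim i j, Matrix.star_apply, map_inv]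
    have hconj : (starRingEnd ℂ) (Circle.coeHom (χ g)) = (Circle.coeHom (χ g))⁻¹ :=
      (Circle.coe_inv_eq_conj (χ g)).symm.trans (Circle.coe_inv (χ g))
    simpa using hconj
  · have h' := congrFun₂ (congrArg Subtype.val h) 0 0
    refine Circle.ext (Eq.trans ?_ h')
    simp [unitaryRepOfStar]
    rfl

variable {A G Q : Type*} [CommGroup A] [Group G] [Group Q] [Finite Q]

/-- Multiplication of a finitely supported family along the fibres of a homomorphism. -/
noncomputable def fiberProd (A : Type*) [CommGroup A] (φ : G →* Q) :
    directPower A G →* directPower A Q where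
  toFun f := ⟨fun q => ∏ᶠ x : {x // φ x = q}, f.1 x, Set.toFinite _⟩
  map_one' := by
    ext q
    simp
  map_mul' f g := by
    ext q
    exact finprod_mul_distrib (Set.Finite.preimage Subtype.val_injective.injOn f.2)
      (Set.Finite.preimage Subtype.val_injective.injOn g.2)

/-- The homomorphism `A ≀ G → A ≀ Q` induced by a homomorphism `G → Q`, for abelian `A`. -/
noncomputable def wreathMap (A : Type*) [CommGroup A] (φ : G →* Q) :
    WreathProduct A G →* WreathProduct A Q :=
  SemidirectProduct.map (fiberProd A φ) φ fun g => by
    ext f q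
    -- Left translation permutes the fibres of `φ`, so fibre products are equivariant.
    let e : {x // φ x = q} ≃ {x // φ x = (φ g)⁻¹ * q} :=
      (Equiv.mulLeft g⁻¹).subtypeEquiv fun x => by simp
    exact finprod_comp_equiv e (f := fun y : {x // φ x = (φ g)⁻¹ * q} => f.1 y)

theorem wreathMap_left_apply (φ : G →* Q) (w : WreathProduct A G) (q : Q) :
    (wreathMap A φ w).left.1 q = ∏ᶠ x : {x // φ x = q}, w.left.1 x := rfl

theorem Group.ResiduallyFinite.exists_disjoint [Group.ResiduallyFinite G] {T : Set G}
    (hT : T.Finite) (h1 : 1 ∉ T) :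
    ∃ N : Subgroup G, N.Normal ∧ N.FiniteIndex ∧ ∀ t ∈ T, t ∉ N := by
  induction T, hT using Set.Finite.induction_on with
  | empty => exact ⟨⊤, inferInstance, inferInstance, by simp⟩
  | @insert a T _ _ ih =>
    obtain ⟨N, hN, hN', h⟩ := ih fun h => h1 (Set.mem_insert_of_mem _ h)
    obtain ⟨K, hK⟩ := Group.exists_finiteIndexNormalSubgroup_notMem a
      fun h => h1 (h ▸ Set.mem_insert _ _)
    refine ⟨N ⊓ K.toSubgroup, inferInstance, inferInstance, ?_⟩
    rintro t (rfl | ht) ⟨h₁, h₂⟩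
    · exact hK h₂
    · exact h t ht h₁

theorem isMAP_wreathProduct_of_residuallyFinite [Group.ResiduallyFinite G] :
    IsMAP (WreathProduct A G) := by
  refine isMAP_of_separating_homs fun w hw => ?_
  suffices h : ∃ N : Subgroup G, ∃ (_ : N.Normal) (_ : N.FiniteIndex),
      wreathMap A (QuotientGroup.mk' N) w ≠ 1 by
    obtain ⟨N, _, _, hN⟩ := h
    exact ⟨_, _, _, isMAP_wreathProduct_of_finite (isMAP_of_commGroup A), hN⟩
  by_cases hr : w.right = 1
  · obtain ⟨x, hx⟩ : ∃ x, w.left.1 x ≠ 1 := by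
      by_contra! h
      exact hw (SemidirectProduct.ext (Subtype.ext (funext h)) hr)
    have hfin : (Function.mulSupport w.left.1).Finite := w.left.2
    -- This choice of `T` makes `x` the only support point in its coset of `N`, so the fibre product
    -- there is a single factor.
    obtain ⟨N, hN, hN', h⟩ := Group.ResiduallyFinite.exists_disjoint
      (T := (fun y => x⁻¹ * y) '' (Function.mulSupport w.left.1 \ {x}))
      ((hfin.sdiff).image _) (by
        rintro ⟨y, ⟨-, hy⟩, h⟩
        exact hy (inv_mul_eq_one.1 h).symm)
    refine ⟨N, hN, hN', fun h1 => hx ?_⟩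
    have h2 := congrArg (fun v => v.left.1 (QuotientGroup.mk' N x)) h1
    simp only [wreathMap_left_apply] at h2
    rw [finprod_eq_single _ (⟨x, rfl⟩ : {y // QuotientGroup.mk' N y = QuotientGroup.mk' N x})]
      at h2
    · exact h2
    · rintro ⟨y, hy⟩ hne
      by_contra hy'
      exact h _ ⟨y, ⟨hy', fun h => hne (Subtype.ext h)⟩, rfl⟩ (QuotientGroup.eq.1 hy.symm)
  · obtain ⟨N, hN⟩ := Group.exists_finiteIndexNormalSubgroup_notMem w.right hr
    refine ⟨N.toSubgroup, inferInstance, inferInstance, fun h => hN ?_⟩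
    exact (QuotientGroup.eq_one_iff _).1 (congrArg SemidirectProduct.right h)

end Abelian

/-- Pigeonhole: finitely many balls of radius `ε / 2` cover the bounded range. -/
theorem exists_ne_norm_sub_lt {α E : Type*} [Infinite α] [NormedAddCommGroup E] [ProperSpace E]
    (f : α → E) {C : ℝ} (hf : ∀ x, ‖f x‖ ≤ C) {ε : ℝ} (hε : 0 < ε) :
    ∃ x y, x ≠ y ∧ ‖f x - f y‖ < ε := by
  obtain ⟨t, ht, hcover⟩ := Metric.totallyBounded_iff.1
    (isCompact_closedBall (0 : E) C).totallyBounded (ε / 2) (half_pos hε)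
  have hx : ∀ x, ∃ c : t, f x ∈ Metric.ball (c : E) (ε / 2) := fun x => by
    have h := hcover (mem_closedBall_zero_iff.2 (hf x))
    simp only [Set.mem_iUnion] at h
    obtain ⟨c, hc, h⟩ := h
    exact ⟨⟨c, hc⟩, h⟩
  choose c hc using hx
  have := ht.to_subtype
  obtain ⟨x, y, hxy, h⟩ := Finite.exists_ne_map_eq_of_infinite c
  refine ⟨x, y, hxy, ?_⟩
  have h1 := hc x
  have h2 := hc y
  rw [h] at h1
  rw [← dist_eq_norm]
  rw [Metric.mem_ball] at h1 h2
  linarith [dist_triangle_right (f x) (f y) (c y)]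

/-! ### Compactness and spectra of unitary matrices. -/

section Unitary

open scoped Matrix.Norms.L2Operator

variable {ι : Type*} [Fintype ι] [DecidableEq ι]

theorem norm_unitaryGroup_le (U : Matrix.unitaryGroup ι ℂ) :
    ‖(U : Matrix ι ι ℂ)‖ ≤ ‖(1 : Matrix ι ι ℂ)‖ := by
  rw [← mul_one (U : Matrix ι ι ℂ)]
  exact (CStarRing.norm_coe_unitary_mul U 1).le

theorem exists_ne_one_norm_sub_one_lt {Γ : Type*} [Group Γ] [Infinite Γ]
    (π : Γ →* Matrix.unitaryGroup ι ℂ) {ε : ℝ} (hε : 0 < ε) :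
    ∃ k : Γ, k ≠ 1 ∧ ‖(π k : Matrix ι ι ℂ) - 1‖ < ε := by
  have : ProperSpace (Matrix ι ι ℂ) := FiniteDimensional.proper ℂ _
  obtain ⟨x, y, hxy, h⟩ := exists_ne_norm_sub_lt (fun g => (π g : Matrix ι ι ℂ))
    (fun g => norm_unitaryGroup_le (π g)) hε
  refine ⟨x⁻¹ * y, fun h => hxy (inv_mul_eq_one.1 h), ?_⟩
  rw [← CStarRing.norm_coe_unitary_mul (π x), mul_sub, mul_one]
  rw [← norm_sub_rev]
  have h' : (π x : Matrix ι ι ℂ) * (π (x⁻¹ * y) : Matrix ι ι ℂ) = π y := by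
    rw [← Submonoid.coe_mul, ← map_mul, mul_inv_cancel_left]
  rwa [h']

/-- If conjugates of `A` by unitaries arbitrarily close to `1` commute with `B`, then so does
`A`. -/
theorem commute_of_forall_conj_commute (A B : Matrix.unitaryGroup ι ℂ)
    (h : ∀ ε > 0, ∃ K : Matrix.unitaryGroup ι ℂ,
      ‖(K : Matrix ι ι ℂ) - 1‖ < ε ∧ Commute (K * A * K⁻¹) B) : Commute A B := by
  suffices h0 : ‖(A * B : Matrix ι ι ℂ) - B * A‖ ≤ 0 by
    exact Subtype.ext (sub_eq_zero.1 (norm_le_zero_iff.1 h0))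
  refine le_of_forall_pos_lt_add fun ε hε => ?_
  -- The factor 4: conjugation by `K` moves `A` by at most `2‖K - 1‖`, and passing to the commutator
  -- with `B` doubles this again.
  obtain ⟨K, hK, hc⟩ := h (ε / 4) (by positivity)
  have hA : ‖(A : Matrix ι ι ℂ) - (K * A * K⁻¹ : Matrix.unitaryGroup ι ℂ)‖ < ε / 2 := by
    rw [← CStarRing.norm_mul_coe_unitary _ K, sub_mul]
    have h1 : ((K * A * K⁻¹ : Matrix.unitaryGroup ι ℂ) : Matrix ι ι ℂ) * K = K * A := by
      rw [← Submonoid.coe_mul, inv_mul_cancel_right, Submonoid.coe_mul]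
    have h2 : (A * K - K * A : Matrix ι ι ℂ) = A * (K - 1) - (K - 1) * A := by noncomm_ring
    rw [h1, h2]
    refine (norm_sub_le _ _).trans_lt ?_
    rw [CStarRing.norm_coe_unitary_mul, CStarRing.norm_mul_coe_unitary]
    linarith
  have hc' : ((K * A * K⁻¹ : Matrix.unitaryGroup ι ℂ) : Matrix ι ι ℂ) * B =
      B * (K * A * K⁻¹ : Matrix.unitaryGroup ι ℂ) := congrArg Subtype.val hc
  generalize ((K * A * K⁻¹ : Matrix.unitaryGroup ι ℂ) : Matrix ι ι ℂ) = A' at hA hc'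
  have h3 : (A * B : Matrix ι ι ℂ) - B * A = (A - A') * B - B * (A - A') := by
    rw [sub_mul, mul_sub, hc']
    abel
  rw [h3, zero_add]
  refine (norm_sub_le _ _).trans_lt ?_
  rw [CStarRing.norm_coe_unitary_mul, CStarRing.norm_mul_coe_unitary]
  linarith

/-- The eigenspace of `f - g` is stable under `f`; an eigenvector of `f` inside it is also one of
`g`. -/
theorem Module.End.exists_sub_eq_of_hasEigenvalue_sub {K V : Type*} [Field K] [IsAlgClosed K]
    [AddCommGroup V] [Module K V] [FiniteDimensional K V] {f g : Module.End K V}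
    (h : Commute f g) {z : K} (hz : (f - g).HasEigenvalue z) :
    ∃ a b, f.HasEigenvalue a ∧ g.HasEigenvalue b ∧ a - b = z := by
  have hmap : ∀ v ∈ (f - g).eigenspace z, f v ∈ (f - g).eigenspace z := fun v hv =>
    Module.End.mapsTo_genEigenspace_of_comm
      ((Commute.refl f).sub_left h.symm) z 1 hv
  have : Nontrivial ((f - g).eigenspace z) := Submodule.nontrivial_iff_ne_bot.2 hz
  obtain ⟨a, ha⟩ := Module.End.exists_eigenvalue (f.restrict hmap)
  obtain ⟨⟨v, hv⟩, hva⟩ := ha.exists_hasEigenvector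
  have hv0 : v ≠ 0 := fun h => hva.2 (Subtype.ext h)
  have hfv : f v = a • v := congrArg Subtype.val hva.apply_eq_smul
  have hgv : g v = (a - z) • v := by
    have h1 := Module.End.mem_eigenspace_iff.1 hv
    rw [LinearMap.sub_apply, hfv] at h1
    rw [sub_smul, ← h1, sub_sub_cancel]
  exact ⟨a, a - z, Module.End.hasEigenvalue_of_hasEigenvector
    ⟨Module.End.mem_eigenspace_iff.2 hfv, hv0⟩, Module.End.hasEigenvalue_of_hasEigenvector
    ⟨Module.End.mem_eigenspace_iff.2 hgv, hv0⟩, sub_sub_cancel a z⟩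

theorem Matrix.exists_sub_eq_of_mem_spectrum_sub {A B : Matrix ι ι ℂ} (h : Commute A B) {z : ℂ}
    (hz : z ∈ spectrum ℂ (A - B)) : ∃ a ∈ spectrum ℂ A, ∃ b ∈ spectrum ℂ B, a - b = z := by
  rw [← Matrix.spectrum_toLin', map_sub, ← Module.End.hasEigenvalue_iff_mem_spectrum] at hz
  have h' : Commute (Matrix.toLin' A) (Matrix.toLin' B) := h.map (Matrix.toLinAlgEquiv' (R := ℂ))
  obtain ⟨a, b, ha, hb, hab⟩ := Module.End.exists_sub_eq_of_hasEigenvalue_sub h' hz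
  rw [Module.End.hasEigenvalue_iff_mem_spectrum, Matrix.spectrum_toLin'] at ha hb
  exact ⟨a, ha, b, hb, hab⟩

/-- A commuting family of unitary matrices whose eigenvalues lie in a fixed finite set is
finite. -/
theorem finite_of_pairwise_commute_of_spectrum_subset {S : Set (Matrix.unitaryGroup ι ℂ)}
    {T : Set ℂ} (hT : T.Finite) (hST : ∀ U ∈ S, spectrum ℂ (U : Matrix ι ι ℂ) ⊆ T)
    (hS : ∀ U ∈ S, ∀ V ∈ S, Commute U V) : S.Finite := by
  by_contra hinf
  have : Infinite S := Set.infinite_coe_iff.2 hinf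
  have : ProperSpace (Matrix ι ι ℂ) := FiniteDimensional.proper ℂ _
  have hfin : (Set.image2 (· - ·) T T \ {0}).Finite := (hT.image2 _ hT).sdiff
  -- Nonzero differences of points of the finite set `T` are bounded away from 0.
  obtain ⟨ε, hε, hdist⟩ : ∃ ε > 0, ∀ z ∈ Set.image2 (· - ·) T T \ {0}, ε ≤ ‖z‖ := by
    have h0 : ∀ᶠ ε in nhdsWithin (0 : ℝ) (Set.Ioi 0),
        ∀ z ∈ Set.image2 (· - ·) T T \ {0}, ε ≤ ‖z‖ :=
      (Filter.eventually_all_finite hfin).2 fun z hz =>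
        Filter.mem_of_superset (Ioc_mem_nhdsGT (norm_pos_iff.2 hz.2)) fun _ h => h.2
    obtain ⟨ε, h, hε⟩ := (h0.and self_mem_nhdsWithin).exists
    exact ⟨ε, hε, h⟩
  obtain ⟨⟨U, hU⟩, ⟨V, hV⟩, hUV, hlt⟩ := exists_ne_norm_sub_lt
    (fun U : S => ((U : Matrix.unitaryGroup ι ℂ) : Matrix ι ι ℂ))
    (fun U => norm_unitaryGroup_le U.1) hε
  have hne : (U : Matrix ι ι ℂ) - V ≠ 0 := fun h =>
    hUV (Subtype.ext (Subtype.ext (sub_eq_zero.1 h)))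
  have hcomm : Commute (U : Matrix ι ι ℂ) V := congrArg Subtype.val (hS U hU V hV)
  have hstar : ∀ W X : Matrix.unitaryGroup ι ℂ, Commute W X →
      Commute (star (W : Matrix ι ι ℂ)) (X : Matrix ι ι ℂ) := fun W X h =>
    congrArg Subtype.val (h.inv_left : Commute W⁻¹ X)
  -- Normality makes the norm of `U - V` the modulus of one of its eigenvalues, a nonzero difference
  -- of points of `T`; this contradicts the norm being below `ε`.
  have : IsStarNormal ((U : Matrix ι ι ℂ) - V) := ⟨by
    rw [star_sub]
    exact ((hstar U U (Commute.refl U)).sub_right (hstar U V (hS U hU V hV))).sub_left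
      ((hstar V U (hS V hV U hU)).sub_right (hstar V V (Commute.refl V)))⟩
  have : Nontrivial (Matrix ι ι ℂ) := ⟨_, _, hne⟩
  obtain ⟨z, hz, hzn⟩ := spectrum.exists_nnnorm_eq_spectralRadius ((U : Matrix ι ι ℂ) - V)
  rw [IsStarNormal.spectralRadius_eq_nnnorm, ENNReal.coe_inj] at hzn
  have hzn' : ‖z‖ = ‖(U : Matrix ι ι ℂ) - V‖ := congrArg NNReal.toReal hzn
  obtain ⟨a, ha, b, hb, rfl⟩ := Matrix.exists_sub_eq_of_mem_spectrum_sub hcomm hz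
  have hε' := hdist (a - b) ⟨⟨a, hST U hU ha, b, hST V hV hb, rfl⟩, fun h => hne <| by
    rw [← norm_eq_zero, ← hzn', h, norm_zero]⟩
  linarith

/-- If the conjugates of `U` under a group of unitaries commute, then a finite-index subgroup
centralizes `U`. -/
theorem finiteIndex_comap_centralizer {Γ : Type*} [Group Γ] (π : Γ →* Matrix.unitaryGroup ι ℂ)
    (U : Matrix.unitaryGroup ι ℂ)
    (h : ∀ g k : Γ, Commute (π g * U * (π g)⁻¹) (π k * U * (π k)⁻¹)) :
    ((Subgroup.centralizer {U}).comap π).FiniteIndex := by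
  let : MulAction Γ (Matrix.unitaryGroup ι ℂ) := MulAction.compHom _ (MulAut.conj.comp π)
  have hsmul : ∀ g : Γ, g • U = π g * U * (π g)⁻¹ := fun g => rfl
  have hst : (Subgroup.centralizer {U}).comap π = MulAction.stabilizer Γ U := by
    ext g
    rw [Subgroup.mem_comap, Subgroup.mem_centralizer_singleton_iff, MulAction.mem_stabilizer_iff,
      hsmul, mul_inv_eq_iff_eq_mul]
  have hfin : (MulAction.orbit Γ U).Finite := by
    refine finite_of_pairwise_commute_of_spectrum_subset
      (Matrix.finite_spectrum (U : Matrix ι ι ℂ)) ?_ ?_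
    · rintro _ ⟨g, rfl⟩
      exact (spectrum.units_conjugate (R := ℂ) (a := (U : Matrix ι ι ℂ))
        (u := Unitary.toUnits (π g))).le
    · rintro _ ⟨g, rfl⟩ _ ⟨k, rfl⟩
      exact h g k
  rw [hst]
  refine ⟨?_⟩
  rw [MulAction.index_stabilizer]
  exact ((Set.ncard_pos hfin).2 (MulAction.nonempty_orbit U)).ne'

end Unitary

/-! ### Commuting copies of `H` in the wreath product, and necessity. -/

section Necessity

variable {H G : Type*} [Group H]

open scoped Classical in
/-- The embedding of `H` in `⊕_{g ∈ G} H` as the factor at `g`. -/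
noncomputable def directPowerSingle (H : Type*) {G : Type*} [Group H] (g : G) :
    H →* directPower H G :=
  (MonoidHom.mulSingle (fun _ : G => H) g).codRestrict _ fun _ =>
    (Set.finite_singleton g).subset Pi.mulSupport_mulSingle_subset

theorem directPowerSingle_self (g : G) (a : H) : (directPowerSingle H g a).1 g = a :=
  open scoped Classical in Pi.mulSingle_eq_same (M := fun _ : G => H) g a

theorem directPowerSingle_ne {g k : G} (h : k ≠ g) (a : H) :
    (directPowerSingle H g a).1 k = 1 :=
  open scoped Classical in Pi.mulSingle_eq_of_ne (M := fun _ : G => H) h a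

theorem commute_directPowerSingle {g k : G} (h : g ≠ k) (a b : H) :
    Commute (directPowerSingle H g a) (directPowerSingle H k b) := by
  ext x
  change (directPowerSingle H g a).1 x * (directPowerSingle H k b).1 x =
    (directPowerSingle H k b).1 x * (directPowerSingle H g a).1 x
  by_cases hx : x = g
  · rw [directPowerSingle_ne (hx ▸ h : x ≠ k), mul_one, one_mul]
  · rw [directPowerSingle_ne hx, mul_one, one_mul]

variable [Group G]

theorem shiftAction_directPowerSingle (g k : G) (a : H) :
    shiftAction H G g (directPowerSingle H k a) = directPowerSingle H (g * k) a := by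
  ext x
  change (directPowerSingle H k a).1 (g⁻¹ * x) = _
  by_cases h : x = g * k
  · subst h
    rw [inv_mul_cancel_left, directPowerSingle_self, directPowerSingle_self]
  · rw [directPowerSingle_ne h, directPowerSingle_ne]
    rwa [ne_eq, inv_mul_eq_iff_eq_mul]

/-- The factor at `g` of the base group, as a subgroup of the wreath product. -/
noncomputable def wreathSingle (H : Type*) {G : Type*} [Group H] [Group G] (g : G) :
    H →* WreathProduct H G :=
  SemidirectProduct.inl.comp (directPowerSingle H g)

theorem wreathSingle_injective (g : G) : Function.Injective (wreathSingle H g) := by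
  intro a b h
  have h' := congrArg (fun w => w.left.1 g) h
  change (directPowerSingle H g a).1 g = (directPowerSingle H g b).1 g at h'
  rwa [directPowerSingle_self, directPowerSingle_self] at h'

theorem commute_wreathSingle {g k : G} (h : g ≠ k) (a b : H) :
    Commute (wreathSingle H g a) (wreathSingle H k b) :=
  (commute_directPowerSingle h a b).map SemidirectProduct.inl

theorem conj_wreathSingle (g k : G) (a : H) :
    SemidirectProduct.inr g * wreathSingle H k a * (SemidirectProduct.inr g)⁻¹ =
      wreathSingle H (g * k) a := by
  rw [← map_inv]
  exact (SemidirectProduct.inl_aut g _).symm.trans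
    (congrArg SemidirectProduct.inl (shiftAction_directPowerSingle g k a))

theorem IsMAP.commute_of_infinite [Infinite G] (h : IsMAP (WreathProduct H G)) (a b : H) :
    a * b = b * a := by
  by_contra hab
  obtain ⟨n, π, hπ⟩ := h (wreathSingle H (1 : G) (a * b)) (wreathSingle H (1 : G) (b * a))
    fun h => hab (wreathSingle_injective _ h)
  refine hπ ?_
  rw [map_mul, map_mul, map_mul, map_mul]
  refine commute_of_forall_conj_commute _ _ fun ε hε => ?_
  obtain ⟨k, hk, hlt⟩ := exists_ne_one_norm_sub_one_lt
    (π.comp (SemidirectProduct.inr : G →* WreathProduct H G)) hε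
  refine ⟨_, hlt, ?_⟩
  rw [MonoidHom.comp_apply, ← map_inv, ← map_mul, ← map_mul, conj_wreathSingle, mul_one]
  exact (commute_wreathSingle hk a b).map π

theorem IsMAP.residuallyFinite_of_nontrivial [Nontrivial H]
    (h : IsMAP (WreathProduct H G)) : Group.ResiduallyFinite G := by
  refine Group.residuallyFinite_iff_exists_finiteIndex.2 fun g hg => ?_
  obtain ⟨a, ha⟩ := exists_ne (1 : H)
  have hne : wreathSingle H g a ≠ wreathSingle H 1 a := by
    intro h
    have h' := congrArg (fun w => w.left.1 g) h
    change (directPowerSingle H g a).1 g = (directPowerSingle H 1 a).1 g at h'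
    rw [directPowerSingle_self, directPowerSingle_ne hg] at h'
    exact ha h'
  obtain ⟨n, π, hπ⟩ := h _ _ hne
  have hconj : ∀ k : G, π (SemidirectProduct.inr k) * π (wreathSingle H 1 a) *
      (π (SemidirectProduct.inr k))⁻¹ = π (wreathSingle H k a) := fun k => by
    rw [← map_inv, ← map_mul, ← map_mul, conj_wreathSingle, mul_one]
  refine ⟨_, finiteIndex_comap_centralizer
    (π.comp (SemidirectProduct.inr : G →* WreathProduct H G)) (π (wreathSingle H 1 a)) ?_, ?_⟩
  · intro k l
    rw [MonoidHom.comp_apply, MonoidHom.comp_apply, hconj, hconj]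
    by_cases hkl : k = l
    · rw [hkl]
    · exact (commute_wreathSingle hkl a a).map π
  -- If `g` centralized the image of `a` at `1`, the images of `a` at `g` and at `1` would coincide.
  · intro hmem
    rw [Subgroup.mem_comap, Subgroup.mem_centralizer_singleton_iff, MonoidHom.comp_apply,
      ← mul_inv_eq_iff_eq_mul, hconj] at hmem
    exact hπ hmem

end Necessity

theorem mainTheorem6 {H : Type*} {G : Type*} [Group H] [Group G] :
    IsMAP (WreathProduct H G) ↔
      (IsMAP H ∧ Finite G) ∨
      (Subsingleton H ∧ IsMAP G) ∨
      ((∀ a b : H, a * b = b * a) ∧ Group.ResiduallyFinite G) := by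
  constructor
  · intro h
    rcases finite_or_infinite G with hG | hG
    · exact Or.inl ⟨h.of_injective (wreathSingle H (1 : G)) (wreathSingle_injective 1), hG⟩
    rcases subsingleton_or_nontrivial H with hH | hH
    · exact Or.inr (Or.inl ⟨hH, h.of_injective SemidirectProduct.inr
        SemidirectProduct.inr_injective⟩)
    · exact Or.inr (Or.inr ⟨h.commute_of_infinite, h.residuallyFinite_of_nontrivial⟩)
  · rintro (⟨hH, hG⟩ | ⟨hH, hG⟩ | ⟨hH, hG⟩)
    · exact isMAP_wreathProduct_of_finite hH
    · refine hG.of_injective SemidirectProduct.rightHom fun v w h => ?_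
      exact SemidirectProduct.ext (Subtype.ext (Subsingleton.elim _ _)) h
    · let : CommGroup H := { ‹Group H› with mul_comm := hH }
      exact isMAP_wreathProduct_of_residuallyFinite
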